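/- Let $U_h=U_h(sl_2)$ be the $h$-adically complete $\mathbb{Q}[[h]]$-algebra topologically generated by $H,E,F$ with relations $$HE-EH=2E,\qquad HF-FH=-2F,\qquad EF-FE=\frac{K-K^{-1}}{q^{1/2}-q^{-1/2}},$$ where $q=\exp h$ and $K=\exp\frac{hH}{2}$. For $n\ge 0$ put $\{n\}_q!=\prod_{i=1}^n(q^i-1)$, $[n]_q!=\prod_{i=1}^n\frac{q^i-1}{q-1}$, $\tilde E^{(n)}=(q^{-1/2}E)^n/[n]_q!$ and $\tilde F^{(n)}=F^nK^n/[n]_q!$. Let $U_{\mathbb{Z},q}^{\mathrm{ev}}\subset U_h$ be the $\mathbb{Z}[q,q^{-1}]$-subalgebra generated by $K^2$, $K^{-2}$, and $\tilde E^{(n)},\tilde F^{(n)}$ for $n\ge 1$. For $m\ge 1$ let $V_m$ be the $m$-dimensional irreducible representation of $U_h$, and let $\mathcal{R}=\mathrm{Span}_{\mathbb{Q}(q^{1/2})}\{V_m\mid m\ge 1\}$ be the representation ring of $U_h$ over $\mathbb{Q}(q^{1/2})$, with multiplication induced by the tensor product. For $Y=\sum_j y_jV_j\in\mathcal{R}$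 and $u\in U_h$ put $\mathrm{tr}_q^Y(u)=\sum_j y_j\,\mathrm{tr}^{V_j}(K^{-1}u)$. For $l\ge 0$ let $$P_l=\prod_{i=0}^{l-1}\bigl(V_2-q^{i+\frac12}-q^{-i-\frac12}\bigr),\qquad \tilde P'_l=\frac{q^{l/2}}{\{l\}_q!}\,P_l\ \in\mathcal{R}.$$ Then for every $l\ge 0$ and every $u\in U_{\mathbb{Z},q}^{\mathrm{ev}}$, $$\{l\}_q!\;\mathrm{tr}_q^{\tilde P'_l}(u)\in\mathbb{Z}[q,q^{-1}].$$ -/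

import Mathlib

open scoped PowerSeries LaurentSeries Kronecker

noncomputable section

namespace QSl2

/-! ## Powers of `q = exp h` and `q`-integers

The variable `h` of `ℚ[[h]]` is the variable `X` of `ℚ⟦X⟧`. -/

/-- `q ^ r = exp (r h)` in `ℚ[[h]]`, for a rational exponent `r`. -/
def qpow (r : ℚ) : ℚ⟦X⟧ := PowerSeries.rescale r (PowerSeries.exp ℚ)

theorem qpow_add (r s : ℚ) : qpow (r + s) = qpow r * qpow s :=
  (PowerSeries.exp_mul_exp_eq_exp_add r s).symm

theorem qpow_zero : qpow 0 = 1 := by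
  simp [qpow]

theorem coeff_qpow (r : ℚ) (n : ℕ) :
    PowerSeries.coeff n (qpow r) = r ^ n / (n.factorial : ℚ) := by
  simp [qpow, PowerSeries.coeff_rescale, PowerSeries.coeff_exp, div_eq_mul_inv]

/-- `{n}_q! = (q ^ n - 1) (q ^ (n-1) - 1) ⋯ (q - 1)`. -/
def braceFact {A : Type*} [CommRing A] (q : A) (n : ℕ) : A :=
  ∏ i ∈ Finset.range n, (q ^ (i + 1) - 1)

/-- `[n]_q = (q ^ n - 1) / (q - 1) = 1 + q + ⋯ + q ^ (n-1)`. -/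
def qInt {A : Type*} [CommRing A] (q : A) (n : ℕ) : A :=
  ∑ i ∈ Finset.range n, q ^ i

theorem qInt_mul {A : Type*} [CommRing A] (q : A) (n : ℕ) :
    qInt q n * (q - 1) = q ^ n - 1 := geom_sum_mul q n

/-- `[n]_q! = [n]_q [n-1]_q ⋯ [1]_q`. -/
def qFact {A : Type*} [CommRing A] (q : A) (n : ℕ) : A :=
  ∏ i ∈ Finset.range n, qInt q (i + 1)

/-- `[n]_q!` is invertible in `ℚ[[h]]`: its constant term is `n!`. -/
theorem qFact_mul_inv (n : ℕ) : qFact (qpow 1) n * (qFact (qpow 1) n)⁻¹ = 1 := by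
  apply PowerSeries.mul_inv_cancel
  have h : PowerSeries.constantCoeff (qpow 1) = 1 := by
    rw [← PowerSeries.coeff_zero_eq_constantCoeff_apply, coeff_qpow]; simp
  simp only [qFact, qInt, map_prod, map_sum, map_pow, h, one_pow, Finset.sum_const,
    Finset.card_range, nsmul_eq_mul, mul_one]
  exact Finset.prod_ne_zero_iff.mpr fun i _ => by positivity

/-- The symmetric quantum integer
`(q ^ (n/2) - q ^ (-n/2)) / (q ^ (1/2) - q ^ (-1/2)) = ∑_{k < n} q ^ ((n-1)/2 - k)`. -/
def symInt (n : ℕ) : ℚ⟦X⟧ :=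
  ∑ k ∈ Finset.range n, qpow (((n : ℚ) - 1) / 2 - k)

theorem symInt_mul (n : ℕ) :
    symInt n * (qpow (1 / 2) - qpow (-1 / 2)) = qpow (n / 2) - qpow (-n / 2) := by
  have h : ∀ k : ℕ, qpow (((n : ℚ) - 1) / 2 - k) * (qpow (1 / 2) - qpow (-1 / 2)) =
      qpow ((n : ℚ) / 2 - (k : ℕ)) - qpow ((n : ℚ) / 2 - ((k + 1 : ℕ) : ℚ)) := by
    intro k
    rw [mul_sub, ← qpow_add, ← qpow_add]
    congr 2
    · ring
    · push_cast; ring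
  rw [symInt, Finset.sum_mul, Finset.sum_congr rfl fun k _ => h k,
    Finset.sum_range_sub' (fun k : ℕ => qpow ((n : ℚ) / 2 - (k : ℚ)))]
  congr 2
  · simp
  · ring

/-- The ring `ℤ[q, q⁻¹]`, as a subring of `ℚ[[h]]`. -/
def Zq : Subalgebra ℤ ℚ⟦X⟧ := Algebra.adjoin ℤ {qpow 1, qpow (-1)}

/-! ## The `h`-adic quantized enveloping algebra -/

/-- The generators `H`, `E`, `F`. -/
inductive Gen | H | E | F

/-- The free associative `ℚ`-algebra on `H`, `E`, `F`. -/
abbrev Free : Type := FreeAlgebra ℚ Gen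

/-- The `h`-adically complete `ℚ[[h]]`-algebra topologically freely generated by `H`, `E`, `F`:
formal power series in the central variable `h` with coefficients in the free algebra. -/
abbrev FreeTop : Type := PowerSeries Free

/-- The image of a scalar of `ℚ[[h]]` in the completed free algebra. -/
def scalar : ℚ⟦X⟧ →+* FreeTop := PowerSeries.map (algebraMap ℚ Free)

theorem scalar_commutes (c : ℚ⟦X⟧) (x : FreeTop) : scalar c * x = x * scalar c := by
  ext n
  rw [PowerSeries.coeff_mul, PowerSeries.coeff_mul, ← Finset.Nat.sum_antidiagonal_swap]
  refine Finset.sum_congr rfl fun p _ => ?_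
  simp only [scalar, PowerSeries.coeff_map, Prod.fst_swap, Prod.snd_swap]
  exact Algebra.commutes _ _

instance : Algebra ℚ⟦X⟧ FreeTop := scalar.toAlgebra' scalar_commutes

/-- A generator, as an element of the completed free algebra. -/
def gen (g : Gen) : FreeTop := PowerSeries.C (FreeAlgebra.ι ℚ g)

/-- `exp (r h H) = ∑ₙ (r ^ n / n!) H ^ n h ^ n` in the completed free algebra. -/
def expH (r : ℚ) : FreeTop :=
  PowerSeries.mk fun n => (r ^ n / (n.factorial : ℚ)) • FreeAlgebra.ι ℚ Gen.H ^ n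

/-- `φ ↦ (φ - φ(0)) / h`. -/
def divh {A : Type*} [Semiring A] (φ : PowerSeries A) : PowerSeries A :=
  PowerSeries.mk fun n => PowerSeries.coeff (n + 1) φ

/-- `(K - K⁻¹) / (q ^ (1/2) - q ^ (-1/2))` with `K = exp (h H / 2)`: numerator and denominator are
both divided by `h`, after which the denominator is a unit of `ℚ[[h]]`. -/
def cartanQuot : FreeTop :=
  (divh (qpow (1 / 2) - qpow (-1 / 2)))⁻¹ • divh (expH (1 / 2) - expH (-1 / 2))

/-- The defining relations `HE - EH = 2E`, `HF - FH = -2F`,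
`EF - FE = (K - K⁻¹) / (q ^ (1/2) - q ^ (-1/2))`. -/
def relations : Set FreeTop :=
  {gen .H * gen .E - gen .E * gen .H - 2 * gen .E,
   gen .H * gen .F - gen .F * gen .H + 2 * gen .F,
   gen .E * gen .F - gen .F * gen .E - cartanQuot}

/-- The `h`-adic closure of the two-sided ideal generated by the relations. -/
def relIdeal : TwoSidedIdeal FreeTop :=
  ⨅ n : ℕ, TwoSidedIdeal.span relations ⊔ TwoSidedIdeal.span {(PowerSeries.X : FreeTop) ^ n}

/-- `U_h = U_h(sl₂)`. -/
abbrev Uh : Type := relIdeal.ringCon.Quotient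

/-- The quotient map onto `U_h`. -/
def toUh : FreeTop →ₐ[ℚ⟦X⟧] Uh :=
  { relIdeal.ringCon.mk' with commutes' := fun _ => rfl }

/-- `E ∈ U_h`. -/
def E : Uh := toUh (gen .E)

/-- `F ∈ U_h`. -/
def F : Uh := toUh (gen .F)

/-- `K = exp (h H / 2) ∈ U_h`. -/
def K : Uh := toUh (expH (1 / 2))

/-- `K⁻¹ = exp (- h H / 2) ∈ U_h`. -/
def Kinv : Uh := toUh (expH (-1 / 2))

theorem expH_eq (r : ℚ) : expH r =
    PowerSeries.map (Polynomial.aeval (R := ℚ) (FreeAlgebra.ι ℚ Gen.H)).toRingHom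
      (PowerSeries.rescale (r • Polynomial.X) (PowerSeries.exp (Polynomial ℚ))) := by
  ext n
  simp only [expH, PowerSeries.coeff_mk, PowerSeries.coeff_map, PowerSeries.coeff_rescale,
    PowerSeries.coeff_exp, smul_pow, AlgHom.toRingHom_eq_coe, RingHom.coe_coe, map_mul, map_smul,
    map_pow, Polynomial.aeval_X, AlgHom.commutes]
  rw [← Algebra.commutes, ← Algebra.smul_def, smul_smul]
  congr 1
  ring

theorem expH_add (r s : ℚ) : expH (r + s) = expH r * expH s := by
  rw [expH_eq, expH_eq, expH_eq, ← map_mul, PowerSeries.exp_mul_exp_eq_exp_add, add_smul]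

theorem expH_zero : expH 0 = 1 := by
  ext n
  rcases n with _ | n <;> simp [expH, PowerSeries.coeff_one]

theorem K_mul_Kinv : K * Kinv = 1 := by
  rw [K, Kinv, ← map_mul, ← expH_add]
  norm_num [expH_zero]

theorem Kinv_mul_K : Kinv * K = 1 := by
  rw [K, Kinv, ← map_mul, ← expH_add]
  norm_num [expH_zero]

/-- `Ẽ⁽ⁿ⁾ = (q ^ (-1/2) E) ^ n / [n]_q!`. -/
def Etil (n : ℕ) : Uh := (qFact (qpow 1) n)⁻¹ • (qpow (-1 / 2) • E) ^ n

/-- `F̃⁽ⁿ⁾ = F ^ n K ^ n / [n]_q!`. -/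
def Ftil (n : ℕ) : Uh := (qFact (qpow 1) n)⁻¹ • (F ^ n * K ^ n)

/-- The even part of the Lusztig-type integral form: the `ℤ[q, q⁻¹]`-subalgebra of `U_h` generated
by `K²`, `K⁻²`, and `Ẽ⁽ⁿ⁾`, `F̃⁽ⁿ⁾` for `n ≥ 1`. -/
def UZqEv : Subalgebra Zq Uh :=
  Algebra.adjoin Zq
    ({K ^ 2, Kinv ^ 2} ∪ {x | ∃ n : ℕ, 1 ≤ n ∧ x = Etil n} ∪ {x | ∃ n : ℕ, 1 ≤ n ∧ x = Ftil n})

/-! ## Finite-rank representations -/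

open Matrix

/-- `q ^ (r H)` on a module with a basis of weight vectors of weights `w`. -/
def qdiag {ι : Type} [DecidableEq ι] (w : ι → ℤ) (r : ℚ) : Matrix ι ι ℚ⟦X⟧ :=
  diagonal fun i => qpow (r * w i)

/-- A representation of `U_h` on a free `ℚ[[h]]`-module with a finite basis of weight vectors:
`H` acts diagonally with integer weights `w`, and `E`, `F` act by the given matrices. The last
field is the third defining relation, multiplied by `q ^ (1/2) - q ^ (-1/2)`. -/
structure WeightRep (ι : Type) [Fintype ι] [DecidableEq ι] where
  w : ι → ℤ
  e : Matrix ι ι ℚ⟦X⟧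
  f : Matrix ι ι ℚ⟦X⟧
  e_ne : ∀ i j, e i j ≠ 0 → w i = w j + 2
  f_ne : ∀ i j, f i j ≠ 0 → w i = w j - 2
  ef : (qpow (1 / 2) - qpow (-1 / 2)) • (e * f - f * e) = qdiag w (1 / 2) - qdiag w (-1 / 2)

namespace WeightRep

set_option linter.unusedSectionVars false

variable {ι κ : Type} [Fintype ι] [DecidableEq ι] [Fintype κ] [DecidableEq κ]

/-- The action of the generators. -/
def genAct (V : WeightRep ι) : Gen → Matrix ι ι ℚ⟦X⟧
  | .H => diagonal fun i => (V.w i : ℚ⟦X⟧)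
  | .E => V.e
  | .F => V.f

/-- The action of the free algebra. -/
def freeAct (V : WeightRep ι) : Free →ₐ[ℚ] Matrix ι ι ℚ⟦X⟧ := FreeAlgebra.lift ℚ V.genAct

/-- The value of the `h`-adically convergent series `∑ₙ aₙ hⁿ`, for a sequence of matrices `aₙ`
over `ℚ[[h]]`. -/
def hsum (a : ℕ → Matrix ι ι ℚ⟦X⟧) : Matrix ι ι ℚ⟦X⟧ :=
  of fun i j => PowerSeries.mk fun N =>
    ∑ p ∈ Finset.HasAntidiagonal.antidiagonal N, PowerSeries.coeff p.2 (a p.1 i j)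

theorem sum_antidiagonal_exchange {A : Type*} [AddCommMonoid A] (G : ℕ → ℕ → ℕ → ℕ → A) (N : ℕ) :
    ∑ p ∈ Finset.HasAntidiagonal.antidiagonal N, ∑ r ∈ Finset.HasAntidiagonal.antidiagonal p.1, ∑ s ∈ Finset.HasAntidiagonal.antidiagonal p.2,
      G r.1 r.2 s.1 s.2 =
    ∑ p ∈ Finset.HasAntidiagonal.antidiagonal N, ∑ r ∈ Finset.HasAntidiagonal.antidiagonal p.1, ∑ s ∈ Finset.HasAntidiagonal.antidiagonal p.2,
      G r.1 s.1 r.2 s.2 := by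
  simp only [← Finset.sum_product', Finset.sum_sigma']
  refine Finset.sum_nbij'
    (fun x => ⟨(x.2.1.1 + x.2.2.1, x.2.1.2 + x.2.2.2), ((x.2.1.1, x.2.2.1), (x.2.1.2, x.2.2.2))⟩)
    (fun x => ⟨(x.2.1.1 + x.2.2.1, x.2.1.2 + x.2.2.2), ((x.2.1.1, x.2.2.1), (x.2.1.2, x.2.2.2))⟩)
    ?_ ?_ ?_ ?_ ?_
  all_goals
    rintro ⟨⟨a, b⟩, ⟨⟨c, d⟩, ⟨e, f⟩⟩⟩ h
    simp only [Finset.mem_sigma, Finset.mem_product, Finset.HasAntidiagonal.mem_antidiagonal] at h ⊢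
  · obtain ⟨h1, rfl, rfl⟩ := h
    refine ⟨?_, trivial, trivial⟩
    change c + d + (e + f) = N at h1
    change c + e + (d + f) = N
    rw [← h1]; ring
  · obtain ⟨h1, rfl, rfl⟩ := h
    refine ⟨?_, trivial, trivial⟩
    change c + d + (e + f) = N at h1
    change c + e + (d + f) = N
    rw [← h1]; ring
  · obtain ⟨h1, rfl, rfl⟩ := h; rfl
  · obtain ⟨h1, rfl, rfl⟩ := h; rfl

theorem hsum_mul (a b : ℕ → Matrix ι ι ℚ⟦X⟧) :
    hsum (fun n => ∑ p ∈ Finset.HasAntidiagonal.antidiagonal n, a p.1 * b p.2) = hsum a * hsum b := by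
  ext i j N
  simp only [hsum, of_apply, PowerSeries.coeff_mk, mul_apply, map_sum, PowerSeries.coeff_mul,
    Matrix.sum_apply]
  rw [Finset.sum_congr rfl fun p _ => Finset.sum_comm, Finset.sum_comm]
  refine Finset.sum_congr rfl fun k _ => ?_
  rw [sum_antidiagonal_exchange
    (fun c d e f => PowerSeries.coeff e (a c i k) * PowerSeries.coeff f (b d k j))]
  simp only [Finset.sum_mul_sum]

theorem hsum_single (A : Matrix ι ι ℚ⟦X⟧) : hsum (fun n => if n = 0 then A else 0) = A := by
  ext i j N
  simp only [hsum, of_apply, PowerSeries.coeff_mk]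
  rw [Finset.sum_eq_single (0, N)]
  · simp
  · rintro ⟨a, b⟩ h hne
    have : a ≠ 0 := by
      rintro rfl
      simp at h
      simp [h] at hne
    simp [this]
  · simp

/-- The `h`-adically continuous extension of the action to the completed free algebra. -/
def topAct (V : WeightRep ι) : FreeTop →+* Matrix ι ι ℚ⟦X⟧ where
  toFun x := hsum fun n => V.freeAct (PowerSeries.coeff n x)
  map_one' := by
    rw [← hsum_single (1 : Matrix ι ι ℚ⟦X⟧)]
    congr 1
    funext n
    rw [PowerSeries.coeff_one]
    split_ifs <;> simp
  map_zero' := by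
    ext i j N
    simp [hsum]
  map_mul' x y := by
    rw [← hsum_mul]
    congr 1
    funext n
    simp [PowerSeries.coeff_mul]
  map_add' x y := by
    ext i j N
    simp [hsum, Finset.sum_add_distrib]

theorem topAct_apply (V : WeightRep ι) (x : FreeTop) :
    V.topAct x = hsum fun n => V.freeAct (PowerSeries.coeff n x) := rfl

theorem topAct_C (V : WeightRep ι) (a : Free) : V.topAct (PowerSeries.C a) = V.freeAct a := by
  rw [topAct_apply, ← hsum_single (V.freeAct a)]
  congr 1
  funext n
  rw [PowerSeries.coeff_C]
  split_ifs <;> simp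

theorem topAct_gen (V : WeightRep ι) (g : Gen) : V.topAct (gen g) = V.genAct g := by
  rw [gen, topAct_C, freeAct, FreeAlgebra.lift_ι_apply]

theorem topAct_scalar (V : WeightRep ι) (c : ℚ⟦X⟧) : V.topAct (scalar c) = c • 1 := by
  ext i j N
  simp only [topAct_apply, hsum, of_apply, PowerSeries.coeff_mk, scalar, PowerSeries.coeff_map,
    AlgHom.commutes]
  rw [Finset.sum_eq_single (N, 0)]
  · by_cases hij : i = j
    · subst hij
      simp [Algebra.algebraMap_eq_smul_one]
    · simp [Algebra.algebraMap_eq_smul_one, hij]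
  · rintro ⟨a, b⟩ h hne
    have hb : b ≠ 0 := by
      rintro rfl
      simp at h
      simp [h] at hne
    by_cases hij : i = j
    · subst hij
      simp [Algebra.algebraMap_eq_smul_one, PowerSeries.coeff_one, hb]
    · simp [Algebra.algebraMap_eq_smul_one, hij]
  · simp

theorem topAct_smul (V : WeightRep ι) (c : ℚ⟦X⟧) (x : FreeTop) :
    V.topAct (c • x) = c • V.topAct x := by
  rw [Algebra.smul_def, map_mul]
  change V.topAct (scalar c) * _ = _
  rw [topAct_scalar, smul_mul_assoc, one_mul]

theorem scalar_X : scalar PowerSeries.X = PowerSeries.X := by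
  rw [scalar, PowerSeries.map_X]

theorem topAct_expH (V : WeightRep ι) (r : ℚ) : V.topAct (expH r) = qdiag V.w r := by
  have hpow : ∀ n : ℕ, V.freeAct ((r ^ n / (n.factorial : ℚ)) • FreeAlgebra.ι ℚ Gen.H ^ n) =
      diagonal fun i => PowerSeries.C (((r * V.w i) ^ n / (n.factorial : ℚ))) := by
    intro n
    rw [map_smul, map_pow, freeAct, FreeAlgebra.lift_ι_apply, genAct, diagonal_pow]
    ext i j : 1
    by_cases hij : i = j
    · subst hij
      rw [Matrix.smul_apply, diagonal_apply_eq, diagonal_apply_eq, Pi.pow_apply,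
        show ((V.w i : ℤ) : ℚ⟦X⟧) = PowerSeries.C (V.w i : ℚ) by simp, ← map_pow,
        PowerSeries.smul_eq_C_mul, ← map_mul]
      congr 1
      ring
    · simp [hij]
  ext i j N
  simp only [topAct_apply, hsum, of_apply, PowerSeries.coeff_mk, expH, hpow]
  by_cases hij : i = j
  · subst hij
    rw [Finset.sum_eq_single (N, 0)]
    · simp [qdiag, coeff_qpow]
    · rintro ⟨a, b⟩ h hne
      have hb : b ≠ 0 := by
        rintro rfl
        simp at h
        simp [h] at hne
      simp [PowerSeries.coeff_C, hb]
    · simp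
  · simp [qdiag, hij]

theorem X_mul_divh {A : Type*} [Semiring A] (φ : PowerSeries A)
    (h : PowerSeries.constantCoeff φ = 0) : PowerSeries.X * divh φ = φ := by
  ext n
  rcases n with _ | n
  · simp [h]
  · rw [PowerSeries.coeff_succ_X_mul, divh, PowerSeries.coeff_mk]

theorem qden_eq : PowerSeries.X * divh (qpow (1 / 2) - qpow (-1 / 2)) =
    qpow (1 / 2) - qpow (-1 / 2) := by
  apply X_mul_divh
  rw [← PowerSeries.coeff_zero_eq_constantCoeff_apply, map_sub, coeff_qpow, coeff_qpow]
  simp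

/-- The denominator `(q ^ (1/2) - q ^ (-1/2)) / h` is a unit of `ℚ[[h]]`. -/
theorem qden_inv : divh (qpow (1 / 2) - qpow (-1 / 2)) *
    (divh (qpow (1 / 2) - qpow (-1 / 2)))⁻¹ = 1 := by
  apply PowerSeries.mul_inv_cancel
  rw [← PowerSeries.coeff_zero_eq_constantCoeff_apply, divh, PowerSeries.coeff_mk, map_sub,
    coeff_qpow, coeff_qpow]
  norm_num

theorem qden_ne : qpow (1 / 2) - qpow (-1 / 2) ≠ 0 := by
  rw [← qden_eq]
  exact mul_ne_zero PowerSeries.X_ne_zero (left_ne_zero_of_mul_eq_one qden_inv)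

/-- `cartanQuot` times its denominator is `K - K⁻¹`. -/
theorem qden_smul_cartanQuot : (qpow (1 / 2) - qpow (-1 / 2)) • cartanQuot =
    expH (1 / 2) - expH (-1 / 2) := by
  have h : (PowerSeries.X : ℚ⟦X⟧) • divh (expH (1 / 2) - expH (-1 / 2)) =
      expH (1 / 2) - expH (-1 / 2) := by
    rw [Algebra.smul_def]
    change scalar PowerSeries.X * _ = _
    rw [scalar_X]
    apply X_mul_divh
    rw [← PowerSeries.coeff_zero_eq_constantCoeff_apply, map_sub]
    simp [expH]
  conv_lhs => rw [← qden_eq]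
  rw [cartanQuot, smul_smul, mul_assoc, qden_inv, mul_one, h]

theorem topAct_relations (V : WeightRep ι) {x : FreeTop} (hx : x ∈ relations) :
    V.topAct x = 0 := by
  rcases hx with rfl | rfl | rfl
  · simp only [map_sub, map_mul, topAct_gen, genAct, map_ofNat]
    ext i j : 1
    rw [Matrix.sub_apply, Matrix.sub_apply, diagonal_mul, mul_diagonal, two_mul, Matrix.add_apply,
      Matrix.zero_apply]
    by_cases h : V.e i j = 0
    · simp [h]
    · rw [V.e_ne i j h]; push_cast; ring
  · simp only [map_sub, map_add, map_mul, topAct_gen, genAct, map_ofNat]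
    ext i j : 1
    rw [Matrix.add_apply, Matrix.sub_apply, diagonal_mul, mul_diagonal, two_mul, Matrix.add_apply,
      Matrix.zero_apply]
    by_cases h : V.f i j = 0
    · simp [h]
    · rw [V.f_ne i j h]; push_cast; ring
  · have h : (qpow (1 / 2) - qpow (-1 / 2)) •
        V.topAct (gen .E * gen .F - gen .F * gen .E - cartanQuot) = 0 := by
      rw [map_sub, smul_sub, ← topAct_smul, ← topAct_smul, qden_smul_cartanQuot, topAct_smul]
      simp only [map_sub, map_mul, topAct_gen, genAct, topAct_expH]
      rw [V.ef, sub_self]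
    exact (smul_eq_zero.mp h).resolve_left qden_ne

theorem topAct_relIdeal (V : WeightRep ι) {x : FreeTop} (hx : x ∈ relIdeal) :
    V.topAct x = 0 := by
  rw [relIdeal, TwoSidedIdeal.mem_iInf] at hx
  ext i j N
  obtain ⟨y, hy, z, hz, rfl⟩ := TwoSidedIdeal.mem_sup.mp (hx (N + 1))
  have h1 : V.topAct y = 0 := by
    have : TwoSidedIdeal.span relations ≤ TwoSidedIdeal.ker V.topAct := by
      rw [TwoSidedIdeal.span_le]
      intro r hr
      exact (TwoSidedIdeal.mem_ker _).mpr (V.topAct_relations hr)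
    exact (TwoSidedIdeal.mem_ker _).mp (this hy)
  have h2 : (PowerSeries.X : FreeTop) ^ (N + 1) ∣ z := by
    clear hx
    induction hz using TwoSidedIdeal.span_induction with
    | mem a h => rw [Set.mem_singleton_iff.mp h]
    | zero => exact dvd_zero _
    | add a b _ _ ha hb => exact dvd_add ha hb
    | neg a _ ha => exact (dvd_neg).mpr ha
    | left_absorb a b _ hb =>
      obtain ⟨c, rfl⟩ := hb
      refine ⟨a * c, ?_⟩
      rw [← mul_assoc, (PowerSeries.commute_X_pow a (N + 1)).eq, mul_assoc]
    | right_absorb a b _ hb => exact hb.mul_right _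
  obtain ⟨c, rfl⟩ := h2
  rw [map_add, h1, zero_add, map_mul, map_pow, ← scalar_X, topAct_scalar, smul_pow, one_pow,
    smul_mul_assoc, one_mul, Matrix.smul_apply, smul_eq_mul, Matrix.zero_apply,
    PowerSeries.coeff_X_pow_mul']
  simp

/-- The representation of `U_h`, as a homomorphism of `ℚ[[h]]`-algebras. -/
def rep (V : WeightRep ι) : Uh →ₐ[ℚ⟦X⟧] Matrix ι ι ℚ⟦X⟧ :=
  relIdeal.ringCon.liftₐ
    { V.topAct with
      commutes' := fun c => by
        change V.topAct (scalar c) = _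
        rw [topAct_scalar, Algebra.algebraMap_eq_smul_one] }
    (by
      intro x y hxy
      rw [TwoSidedIdeal.rel_iff] at hxy
      have h := V.topAct_relIdeal hxy
      rw [map_sub, sub_eq_zero] at h
      exact h)

theorem rep_toUh (V : WeightRep ι) (x : FreeTop) : V.rep (toUh x) = V.topAct x := rfl

theorem qdiag_mul (w : ι → ℤ) (r s : ℚ) : qdiag w r * qdiag w s = qdiag w (r + s) := by
  rw [qdiag, qdiag, qdiag, diagonal_mul_diagonal]
  congr 1
  funext i
  rw [← qpow_add, add_mul]

theorem qdiag_mul_e (V : WeightRep ι) (r : ℚ) :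
    qdiag V.w r * V.e = qpow (2 * r) • (V.e * qdiag V.w r) := by
  ext i j : 1
  rw [Matrix.smul_apply, qdiag, diagonal_mul, mul_diagonal]
  by_cases h : V.e i j = 0
  · simp [h]
  · rw [V.e_ne i j h, smul_eq_mul, mul_left_comm, ← qpow_add, mul_comm]
    congr 2
    push_cast; ring

theorem qdiag_mul_f (V : WeightRep ι) (r : ℚ) :
    qdiag V.w r * V.f = qpow (-(2 * r)) • (V.f * qdiag V.w r) := by
  ext i j : 1
  rw [Matrix.smul_apply, qdiag, diagonal_mul, mul_diagonal]
  by_cases h : V.f i j = 0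
  · simp [h]
  · rw [V.f_ne i j h, smul_eq_mul, mul_left_comm, ← qpow_add, mul_comm]
    congr 2
    push_cast; ring

theorem qdiag_tensor (w : ι → ℤ) (w' : κ → ℤ) (r : ℚ) :
    qdiag (fun p : ι × κ => w p.1 + w' p.2) r = qdiag w r ⊗ₖ qdiag w' r := by
  rw [qdiag, qdiag, qdiag, diagonal_kronecker_diagonal]
  congr 1
  funext p
  rw [← qpow_add]
  congr 1
  push_cast; ring

/-- The tensor product of two representations, for the comultiplication
`Δ(H) = H ⊗ 1 + 1 ⊗ H`, `Δ(E) = E ⊗ 1 + K ⊗ E`, `Δ(F) = F ⊗ K⁻¹ + 1 ⊗ F`. -/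
def tensor (V : WeightRep ι) (W : WeightRep κ) : WeightRep (ι × κ) where
  w p := V.w p.1 + W.w p.2
  e := V.e ⊗ₖ 1 + qdiag V.w (1 / 2) ⊗ₖ W.e
  f := V.f ⊗ₖ qdiag W.w (-1 / 2) + 1 ⊗ₖ W.f
  e_ne := by
    rintro ⟨i, k⟩ ⟨j, l⟩ h
    rw [Matrix.add_apply, kroneckerMap_apply, kroneckerMap_apply] at h
    dsimp only
    by_cases h1 : V.e i j * (1 : Matrix κ κ ℚ⟦X⟧) k l = 0
    · rw [h1, zero_add] at h
      have hi : i = j := by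
        by_contra hij
        exact left_ne_zero_of_mul h (diagonal_apply_ne _ hij)
      rw [hi, W.e_ne _ _ (right_ne_zero_of_mul h)]; ring
    · have hk : k = l := by
        by_contra hkl
        exact right_ne_zero_of_mul h1 (one_apply_ne hkl)
      rw [hk, V.e_ne _ _ (left_ne_zero_of_mul h1)]; ring
  f_ne := by
    rintro ⟨i, k⟩ ⟨j, l⟩ h
    rw [Matrix.add_apply, kroneckerMap_apply, kroneckerMap_apply] at h
    dsimp only
    by_cases h1 : V.f i j * qdiag W.w (-1 / 2) k l = 0
    · rw [h1, zero_add] at h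
      have hi : i = j := by
        by_contra hij
        exact left_ne_zero_of_mul h (one_apply_ne hij)
      rw [hi, W.f_ne _ _ (right_ne_zero_of_mul h)]; ring
    · have hk : k = l := by
        by_contra hkl
        exact right_ne_zero_of_mul h1 (diagonal_apply_ne _ hkl)
      rw [hk, V.f_ne _ _ (left_ne_zero_of_mul h1)]; ring
  ef := by
    have h1 := V.ef
    have h2 := W.ef
    have h3 : (qdiag V.w (1 / 2) * V.f) ⊗ₖ (W.e * qdiag W.w (-1 / 2)) =
        (V.f * qdiag V.w (1 / 2)) ⊗ₖ (qdiag W.w (-1 / 2) * W.e) := by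
      rw [qdiag_mul_f, qdiag_mul_e, smul_kronecker, kronecker_smul]
      norm_num
    have h4 : (V.e ⊗ₖ (1 : Matrix κ κ ℚ⟦X⟧) + qdiag V.w (1 / 2) ⊗ₖ W.e) *
          (V.f ⊗ₖ qdiag W.w (-1 / 2) + (1 : Matrix ι ι ℚ⟦X⟧) ⊗ₖ W.f) -
        (V.f ⊗ₖ qdiag W.w (-1 / 2) + (1 : Matrix ι ι ℚ⟦X⟧) ⊗ₖ W.f) *
          (V.e ⊗ₖ (1 : Matrix κ κ ℚ⟦X⟧) + qdiag V.w (1 / 2) ⊗ₖ W.e) =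
        (V.e * V.f - V.f * V.e) ⊗ₖ qdiag W.w (-1 / 2) +
          qdiag V.w (1 / 2) ⊗ₖ (W.e * W.f - W.f * W.e) := by
      simp only [mul_add, add_mul, ← mul_kronecker_mul, one_mul, mul_one, h3, sub_eq_add_neg,
        add_kronecker, kronecker_add]
      have n1 : (-(V.f * V.e)) ⊗ₖ qdiag W.w (-1 / 2) = -((V.f * V.e) ⊗ₖ qdiag W.w (-1 / 2)) := by
        ext; simp [kroneckerMap_apply]
      have n2 : qdiag V.w (1 / 2) ⊗ₖ (-(W.f * W.e)) = -(qdiag V.w (1 / 2) ⊗ₖ (W.f * W.e)) := by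
        ext; simp [kroneckerMap_apply]
      rw [n1, n2]
      abel
    rw [h4, smul_add, ← smul_kronecker, ← kronecker_smul, h1, h2, qdiag_tensor, qdiag_tensor]
    ext p q : 1
    simp only [Matrix.add_apply, Matrix.sub_apply, kroneckerMap_apply]
    ring

/-- The `m`-dimensional irreducible representation `V_m` (`m ≥ 1`): on the basis
`v_0, …, v_{m-1}`, with symmetric quantum integers `[n]`,
`H v_i = (m - 1 - 2 i) v_i`, `E v_i = [m - i] v_{i-1}`, `F v_i = [i + 1] v_{i+1}`. -/
def irrep (m : ℕ) : WeightRep (Fin m) where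
  w i := (m : ℤ) - 1 - 2 * (i : ℕ)
  e := of fun i j => if (i : ℕ) + 1 = j then symInt (m - j) else 0
  f := of fun i j => if (i : ℕ) = j + 1 then symInt (j + 1) else 0
  e_ne i j h := by
    rw [of_apply] at h
    split_ifs at h with hij
    · rw [← hij]; push_cast; ring
    · exact absurd rfl h
  f_ne i j h := by
    rw [of_apply] at h
    split_ifs at h with hij
    · rw [hij]; push_cast; ring
    · exact absurd rfl h
  ef := by
    have hef : (of fun i j : Fin m => if (i : ℕ) + 1 = j then symInt (m - j) else 0) *
        (of fun i j : Fin m => if (i : ℕ) = j + 1 then symInt (j + 1) else 0) =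
        diagonal fun i : Fin m => symInt (m - (i + 1)) * symInt (i + 1) := by
      ext i j : 1
      rw [mul_apply]
      simp only [of_apply]
      by_cases hi : (i : ℕ) + 1 < m
      · rw [Finset.sum_eq_single ⟨i + 1, hi⟩]
        · by_cases hij : i = j
          · subst hij; simp
          · have : ¬ (i : ℕ) = j := fun h => hij (Fin.ext h)
            simp [hij, this]
        · intro b _ hb
          have : ¬ (i : ℕ) + 1 = b := fun h => hb (Fin.ext h.symm)
          simp [this]
        · simp
      · rw [Finset.sum_eq_zero]
        · have h0 : m - ((i : ℕ) + 1) = 0 := by omega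
          by_cases hij : i = j
          · subst hij; simp [h0, symInt]
          · simp [hij]
        · intro b _
          have : ¬ (i : ℕ) + 1 = b := by have := b.2; omega
          simp [this]
    have hfe : (of fun i j : Fin m => if (i : ℕ) = j + 1 then symInt (j + 1) else 0) *
        (of fun i j : Fin m => if (i : ℕ) + 1 = j then symInt (m - j) else 0) =
        diagonal fun i : Fin m => symInt i * symInt (m - i) := by
      ext i j : 1
      rw [mul_apply]
      simp only [of_apply]
      by_cases hi : 0 < (i : ℕ)
      · have hi' : (i : ℕ) - 1 < m := by have := i.2; omega
        have hi2 : (i : ℕ) - 1 + 1 = i := by omega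
        rw [Finset.sum_eq_single ⟨(i : ℕ) - 1, hi'⟩]
        · simp only [hi2, if_true]
          by_cases hij : i = j
          · subst hij; simp
          · have : ¬ (i : ℕ) = j := fun h => hij (Fin.ext h)
            simp [hij, this]
        · intro b _ hb
          have : ¬ (i : ℕ) = b + 1 := fun h => hb (Fin.ext (by simp; omega))
          simp [this]
        · simp
      · rw [Finset.sum_eq_zero]
        · have h0 : (i : ℕ) = 0 := by omega
          by_cases hij : i = j
          · subst hij; simp [h0, symInt]
          · simp [hij]
        · intro b _
          have : ¬ (i : ℕ) = b + 1 := by omega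
          simp [this]
    rw [hef, hfe, qdiag, qdiag, diagonal_sub, diagonal_sub]
    ext i j : 1
    by_cases hij : i = j
    · subst hij
      simp only [Matrix.smul_apply, diagonal_apply_eq, smul_eq_mul]
      have hc : symInt (i : ℕ) * (qpow (1 / 2) - qpow (-1 / 2)) = _ := symInt_mul (i : ℕ)
      have ha := symInt_mul (m - (i + 1))
      have hb := symInt_mul ((i : ℕ) + 1)
      have hd := symInt_mul (m - i)
      rw [Nat.cast_sub (by omega)] at ha hd
      apply mul_right_cancel₀ qden_ne
      calc _ = (symInt (m - (i + 1)) * (qpow (1 / 2) - qpow (-1 / 2))) *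
              (symInt (i + 1) * (qpow (1 / 2) - qpow (-1 / 2))) -
            (symInt (i : ℕ) * (qpow (1 / 2) - qpow (-1 / 2))) *
              (symInt (m - i) * (qpow (1 / 2) - qpow (-1 / 2))) := by ring
        _ = _ := by
          rw [ha, hb, hc, hd]
          simp only [mul_sub, sub_mul, ← qpow_add]
          push_cast
          ring_nf
    · simp [hij]

/-- The space of homomorphisms of representations `V → W`. -/
def intertwiners (V : WeightRep ι) (W : WeightRep κ) : Submodule ℚ⟦X⟧ (Matrix κ ι ℚ⟦X⟧) where
  carrier := {φ | ∀ u : Uh, W.rep u * φ = φ * V.rep u}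
  add_mem' ha hb u := by rw [Matrix.mul_add, Matrix.add_mul, ha u, hb u]
  zero_mem' u := by simp
  smul_mem' c φ h u := by rw [Matrix.mul_smul, Matrix.smul_mul, h u]

end WeightRep

/-! ## The representation ring and quantum traces -/

/-- The field `ℚ(q ^ (1/2))`, as a subfield of `ℚ((h))`. -/
abbrev Qv : IntermediateField ℚ ℚ⸨X⸩ :=
  IntermediateField.adjoin ℚ {((qpow (1 / 2) : ℚ⟦X⟧) : ℚ⸨X⸩)}

/-- `q ^ (1/2)` as an element of `ℚ(q ^ (1/2))`. -/
def v : Qv := IntermediateField.AdjoinSimple.gen ℚ ((qpow (1 / 2) : ℚ⟦X⟧) : ℚ⸨X⸩)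

/-- The representation ring of `U_h` over `ℚ(q ^ (1/2))`: the vector space with basis
`V_m`, `m ≥ 1`. -/
def RepRing : Type := ℕ+ →₀ Qv

namespace RepRing

instance : AddCommGroup RepRing := inferInstanceAs (AddCommGroup (ℕ+ →₀ Qv))

instance : Module Qv RepRing := inferInstanceAs (Module Qv (ℕ+ →₀ Qv))

/-- The class of the `m`-dimensional irreducible representation. -/
def V (m : ℕ+) : RepRing := Finsupp.single m (1 : Qv)

/-- The multiplicity of `V_c` in `V_a ⊗ V_b`: the rank of the space of homomorphisms
`V_c → V_a ⊗ V_b`. -/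
def mult (a b c : ℕ+) : ℕ :=
  Module.finrank ℚ⟦X⟧ (WeightRep.intertwiners (WeightRep.irrep c)
    ((WeightRep.irrep a).tensor (WeightRep.irrep b)))

/-- The class of `V_a ⊗ V_b`. A constituent of `V_a ⊗ V_b` has dimension at most `a b`. -/
def tensorClass (a b : ℕ+) : RepRing :=
  ∑ c ∈ Finset.Icc 1 (a * b), (mult a b c : Qv) • V c

/-- The multiplication induced by the tensor product of representations. -/
instance : Mul RepRing where
  mul x y := Finsupp.sum x fun a s => Finsupp.sum y fun b t => (s * t) • tensorClass a b

/-- The unit is the class of the trivial representation. -/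
instance : One RepRing := ⟨V 1⟩

/-- `P_l = ∏_{i=0}^{l-1} (V_2 - q ^ (i + 1/2) - q ^ (-i - 1/2))`. -/
def P : ℕ → RepRing
  | 0 => 1
  | l + 1 => P l * (V 2 - v ^ (2 * l + 1) • (1 : RepRing) - (v ^ (2 * l + 1))⁻¹ • (1 : RepRing))

/-- `P̃'_l = q ^ (l/2) / {l}_q! · P_l`. -/
def Ptilde (l : ℕ) : RepRing := (v ^ l / braceFact (v ^ 2) l) • P l

end RepRing

/-- The quantum trace `tr_q^Y(u) = ∑_j y_j tr^{V_j}(K⁻¹ u)` for `Y = ∑_j y_j V_j`, with values in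
`ℚ((h))`. -/
def trq (Y : RepRing) (u : Uh) : ℚ⸨X⸩ :=
  Finsupp.sum Y fun m y => (y : ℚ⸨X⸩) *
    ((((WeightRep.irrep m).rep (Kinv * u)).trace : ℚ⟦X⟧) : ℚ⸨X⸩)

end QSl2

end

namespace QSl2

open Matrix

/-! ## Integrality of Gaussian binomials -/

/-! The prefactor `{l}_q!` cancels the denominator of `P̃'_l`, so what must be shown is `q^(l/2)
tr_q^{P_l}(u) ∈ ℤ[q, q⁻¹]`. No divisibility of `P_l` enters: the only question is which
half-integral powers of `q` occur.

On the representation side, rescaling the weight basis of `V_m` by suitable powers of `q` makes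
every element of the even form act by a matrix over `ℤ[q, q⁻¹]`: divided powers give Gaussian
binomials, and `K²` acts by integral powers of `q` (`gaugeIntegral_rep`). A diagonal rescaling does
not affect diagonal entries, and `K⁻¹` acts by `q^((1-m)/2) q^i`, so `tr^{V_m}(K⁻¹ u)` lies in
`q^((1-m)/2) ℤ[q, q⁻¹]`.

On the representation ring side, weights modulo 2 give a parity grading compatible with the tensor
product. Each factor of `P_l` is odd once `q^(1/2)` is counted as odd, so the coefficient of `V_m`
in `P_l` lies in `q^((l+m-1)/2) ℤ[q, q⁻¹]` (`HasParity.P`). The exact Clebsch-Gordan multiplicities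
are not needed, only that they are integers and vanish in the wrong parity. Multiplying,
`tr_q^{P_l}(u) ∈ q^(l/2) ℤ[q, q⁻¹]`. -/

theorem qpow_mem_Zq (k : ℤ) : qpow k ∈ Zq := by
  have h1 : qpow 1 ∈ Zq := Algebra.subset_adjoin (by simp)
  have h2 : qpow (-1) ∈ Zq := Algebra.subset_adjoin (by simp)
  induction k with
  | zero => simp [qpow_zero]
  | succ n ih => push_cast at ih ⊢; rw [qpow_add]; exact Zq.mul_mem ih h1
  | pred n ih => push_cast at ih ⊢; rw [sub_eq_add_neg, qpow_add]; exact Zq.mul_mem ih h2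

theorem qpow_one_pow (n : ℕ) : qpow 1 ^ n = qpow n := by
  induction n with
  | zero => simp [qpow_zero]
  | succ n ih => rw [pow_succ, ih, ← qpow_add]; push_cast; rfl

theorem qInt_add (a n : ℕ) :
    qInt (qpow 1) (a + n) = qInt (qpow 1) a + qpow 1 ^ a * qInt (qpow 1) n := by
  simp only [qInt, Finset.sum_range_add, Finset.mul_sum, pow_add]

/-- A product of `n` consecutive `q`-integers is divisible by `[n]_q!` in `ℤ[q, q⁻¹]`. -/
theorem exists_prod_qInt_eq (a n : ℕ) :
    ∃ p ∈ Zq, ∏ k ∈ Finset.range n, qInt (qpow 1) (a + k + 1) = qFact (qpow 1) n * p := by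
  induction n generalizing a with
  | zero => exact ⟨1, Zq.one_mem, by simp [qFact]⟩
  | succ n ihn =>
    induction a with
    | zero => exact ⟨1, Zq.one_mem, by simp [qFact]⟩
    | succ a iha =>
      obtain ⟨p, hp, h1⟩ := iha
      obtain ⟨r, hr, h2⟩ := ihn (a + 1)
      refine ⟨p + qpow 1 ^ (a + 1) * r, Zq.add_mem hp (Zq.mul_mem ?_ hr), ?_⟩
      · rw [qpow_one_pow]; exact_mod_cast qpow_mem_Zq (a + 1 : ℕ)
      · have h3 : ∏ k ∈ Finset.range (n + 1), qInt (qpow 1) (a + k + 1) =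
            (∏ k ∈ Finset.range n, qInt (qpow 1) (a + 1 + k + 1)) * qInt (qpow 1) (a + 1) := by
          rw [Finset.prod_range_succ']
          simp only [add_zero]
          congr 1
          exact Finset.prod_congr rfl fun k _ => by congr 1; ring
        have h4 : qFact (qpow 1) (n + 1) = qFact (qpow 1) n * qInt (qpow 1) (n + 1) :=
          Finset.prod_range_succ _ _
        -- The `q`-Pascal rule: splitting the last factor as `[a+1] + q^(a+1) [n+1]`, the first term
        -- gives the product of length `n + 1` starting one place lower, the second a product of
        -- length `n` times the missing factor `[n+1]` of `[n+1]_q!`.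
        rw [Finset.prod_range_succ, show a + 1 + n + 1 = (a + 1) + (n + 1) by ring, qInt_add,
          mul_add, ← h3, h1, h2, h4]
        ring

theorem qFact_inv_mul_prod_mem_Zq (a n : ℕ) :
    (qFact (qpow 1) n)⁻¹ * ∏ k ∈ Finset.range n, qInt (qpow 1) (a + k + 1) ∈ Zq := by
  obtain ⟨p, hp, h⟩ := exists_prod_qInt_eq a n
  rwa [h, ← mul_assoc, mul_comm _ (qFact _ n), qFact_mul_inv, one_mul]

theorem symInt_eq (n : ℕ) : symInt n = qpow ((1 - n) / 2) * qInt (qpow 1) n := by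
  rw [symInt, qInt, ← Finset.sum_range_reflect, Finset.mul_sum]
  refine Finset.sum_congr rfl fun k hk => ?_
  have hk := Finset.mem_range.mp hk
  rw [qpow_one_pow, ← qpow_add, Nat.sub_sub, Nat.cast_sub (by omega)]
  congr 1
  push_cast
  ring

/-! ## The action of the even integral form on `V_m` -/

namespace WeightRep

/-- After conjugation by the diagonal matrix with entries `q ^ (g i)`, the entries of `M` lie in
`ℤ[q, q⁻¹]`. -/
def GaugeIntegral {ι : Type} (g : ι → ℚ) (M : Matrix ι ι ℚ⟦X⟧) : Prop :=
  ∀ i j, ∃ p ∈ Zq, M i j = qpow (g i - g j) * p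

/-! ### Gauge-integral matrices form a `ℤ[q, q⁻¹]`-algebra -/

theorem GaugeIntegral.add {ι : Type} {g : ι → ℚ} {M N : Matrix ι ι ℚ⟦X⟧} (hM : GaugeIntegral g M)
    (hN : GaugeIntegral g N) : GaugeIntegral g (M + N) := fun i j => by
  obtain ⟨p, hp, h1⟩ := hM i j
  obtain ⟨r, hr, h2⟩ := hN i j
  exact ⟨p + r, Zq.add_mem hp hr, by rw [Matrix.add_apply, h1, h2, mul_add]⟩

/-- The conjugating exponents telescope: `(g i - g k) + (g k - g j) = g i - g j`. -/
theorem GaugeIntegral.mul {ι : Type} [Fintype ι] {g : ι → ℚ} {M N : Matrix ι ι ℚ⟦X⟧} (hM : GaugeIntegral g M)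
    (hN : GaugeIntegral g N) : GaugeIntegral g (M * N) := fun i j => by
  choose p hp h1 using hM
  choose r hr h2 using hN
  refine ⟨∑ k, p i k * r k j, Zq.sum_mem fun k _ => Zq.mul_mem (hp i k) (hr k j), ?_⟩
  rw [Matrix.mul_apply, Finset.mul_sum]
  refine Finset.sum_congr rfl fun k _ => ?_
  rw [h1, h2, show g i - g j = (g i - g k) + (g k - g j) by ring, qpow_add]
  ring

theorem GaugeIntegral.diagonal {ι : Type} [DecidableEq ι] (g : ι → ℚ) {d : ι → ℚ⟦X⟧} (hd : ∀ i, d i ∈ Zq) :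
    GaugeIntegral g (diagonal d) := fun i j => by
  by_cases h : i = j
  · subst h
    exact ⟨d i, hd i, by simp [qpow_zero]⟩
  · exact ⟨0, Zq.zero_mem, by simp [h]⟩

theorem qdiag_pow {ι : Type} [Fintype ι] [DecidableEq ι] (w : ι → ℤ) (r : ℚ) (n : ℕ) : qdiag w r ^ n = qdiag w (n * r) := by
  induction n with
  | zero => simp [qdiag, qpow_zero]
  | succ n ih => rw [pow_succ, ih, qdiag_mul]; congr 1; push_cast; ring

/-! ### Action of the generators and their divided powers -/

theorem rep_E {ι : Type} [Fintype ι] [DecidableEq ι] (V : WeightRep ι) : V.rep E = V.e := by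
  rw [E, rep_toUh, topAct_gen, genAct]

theorem rep_F {ι : Type} [Fintype ι] [DecidableEq ι] (V : WeightRep ι) : V.rep F = V.f := by
  rw [F, rep_toUh, topAct_gen, genAct]

theorem rep_K {ι : Type} [Fintype ι] [DecidableEq ι] (V : WeightRep ι) : V.rep K = qdiag V.w (1 / 2) := by
  rw [K, rep_toUh, topAct_expH]

theorem rep_Kinv {ι : Type} [Fintype ι] [DecidableEq ι] (V : WeightRep ι) : V.rep Kinv = qdiag V.w (-1 / 2) := by
  rw [Kinv, rep_toUh, topAct_expH]

/-- The exponents that make the action of the even integral form on `V_m` integral. -/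
def gauge (m : ℕ) (i : Fin m) : ℚ := (m : ℚ) * (i : ℕ) / 2 - (i : ℕ) * ((i : ℕ) + 1) / 4

/-- The entry of `q^(-1/2) E` from `v_{i+1}` to `v_i` is `q^((i+1-m)/2) [m-i-1]_q`, and `gauge` is
the solution of `g i - g (i+1) = (i+1-m)/2` with `g 0 = 0`. The remaining `q`-integers are
consecutive, ready for division by `[n]_q!`. -/
theorem irrep_e_pow (m n : ℕ) (i j : Fin m) : ((qpow (-1 / 2) • (irrep m).e) ^ n) i j =
    if (i : ℕ) + n = j then qpow (gauge m i - gauge m j) *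
      ∏ k ∈ Finset.range n, qInt (qpow 1) (m - 1 - j + k + 1) else 0 := by
  induction n generalizing i with
  | zero =>
    by_cases h : i = j
    · subst h; simp [qpow_zero]
    · simp [h, Fin.val_inj]
  | succ n ih =>
    rw [pow_succ', Matrix.mul_apply]
    split_ifs with h
    · have hi : (i : ℕ) + 1 < m := by have := j.2; omega
      rw [Finset.sum_eq_single ⟨i + 1, hi⟩]
      · rw [ih, if_pos (by simp; omega), Matrix.smul_apply, Finset.prod_range_succ]
        simp only [irrep, of_apply, if_true, smul_eq_mul]
        have h1 : m - ((i : ℕ) + 1) = m - 1 - j + n + 1 := by have := j.2; omega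
        have h2 : qpow (gauge m i - gauge m j) = qpow (-1 / 2) *
            qpow ((1 - (m - ((i : ℕ) + 1) : ℕ)) / 2) * qpow (gauge m ⟨i + 1, hi⟩ - gauge m j) := by
          rw [← qpow_add, ← qpow_add, Nat.cast_sub hi.le]
          congr 1
          simp only [gauge]
          push_cast
          ring
        rw [symInt_eq, h2, ← h1]
        ring
      · intro b _ hb
        have : ¬ (i : ℕ) + 1 = b := fun h => hb (Fin.ext h.symm)
        simp [irrep, this]
      · simp
    · refine Finset.sum_eq_zero fun b _ => ?_
      rw [ih]
      by_cases h1 : (i : ℕ) + 1 = b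
      · rw [if_neg (by omega), mul_zero]
      · simp [irrep, h1]

/-- The symmetric integer of `j+k+1` carries the power `q^(-(j+k)/2)`; for `k < n` these exponents
add up to `(j(j-1) - i(i-1))/4`. -/
theorem irrep_f_pow (m n : ℕ) (i j : Fin m) : ((irrep m).f ^ n) i j =
    if (i : ℕ) = j + n then qpow (((j : ℕ) * ((j : ℕ) - 1) - (i : ℕ) * ((i : ℕ) - 1)) / 4) *
      ∏ k ∈ Finset.range n, qInt (qpow 1) (j + k + 1) else 0 := by
  induction n generalizing i with
  | zero =>
    by_cases h : i = j
    · subst h; simp [qpow_zero]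
    · simp [h, Fin.val_inj]
  | succ n ih =>
    rw [pow_succ', Matrix.mul_apply]
    split_ifs with h
    · have hi : (j : ℕ) + n < m := by have := i.2; omega
      rw [Finset.sum_eq_single ⟨j + n, hi⟩]
      · rw [ih, if_pos rfl, Finset.prod_range_succ]
        simp only [irrep, of_apply]
        have h2 : qpow (((j : ℕ) * ((j : ℕ) - 1) - (i : ℕ) * ((i : ℕ) - 1)) / 4) =
            qpow ((1 - ((j + n + 1 : ℕ) : ℚ)) / 2) *
            qpow (((j : ℕ) * ((j : ℕ) - 1) - ((j + n : ℕ) : ℚ) * (((j + n : ℕ) : ℚ) - 1)) / 4) := by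
          rw [← qpow_add, h]
          congr 1
          push_cast
          ring
        rw [if_pos (by omega), symInt_eq, h2]
        ring
      · intro b _ hb
        have : ¬ (i : ℕ) = b + 1 := fun h1 => hb (Fin.ext (by simp; omega))
        simp [irrep, this]
      · simp
    · refine Finset.sum_eq_zero fun b _ => ?_
      rw [ih]
      by_cases h1 : (i : ℕ) = b + 1
      · rw [if_neg (by omega), mul_zero]
      · simp [irrep, h1]

theorem gaugeIntegral_rep_Etil (m n : ℕ) :
    GaugeIntegral (gauge m) ((irrep m).rep (Etil n)) := fun i j => by
  rw [Etil, map_smul, map_pow, map_smul, rep_E, Matrix.smul_apply, irrep_e_pow]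
  split_ifs with h
  · exact ⟨_, qFact_inv_mul_prod_mem_Zq (m - 1 - j) n, by rw [smul_eq_mul]; ring⟩
  · exact ⟨0, Zq.zero_mem, by simp⟩

theorem gaugeIntegral_rep_Ftil (m n : ℕ) :
    GaugeIntegral (gauge m) ((irrep m).rep (Ftil n)) := fun i j => by
  rw [Ftil, map_smul, map_mul, map_pow, map_pow, rep_F, rep_K, qdiag_pow, Matrix.smul_apply, qdiag,
    mul_diagonal, irrep_f_pow]
  split_ifs with h
  · refine ⟨_, Zq.mul_mem (qpow_mem_Zq (-(n * (j : ℕ)) : ℤ)) (qFact_inv_mul_prod_mem_Zq j n), ?_⟩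
    -- The exponent of `F^n` alone differs from the gauge by `n(1-m)/2`, possibly a half-integer.
    -- The factor `K^n` contributes `n(m-1-2j)/2`, leaving the integer `-nj`.
    have h1 : qpow (((j : ℕ) * ((j : ℕ) - 1) - (i : ℕ) * ((i : ℕ) - 1)) / 4) *
        qpow (n * (1 / 2) * (irrep m).w j) =
        qpow (gauge m i - gauge m j) * qpow ((-(n * (j : ℕ)) : ℤ)) := by
      rw [← qpow_add, ← qpow_add]
      congr 1
      simp only [irrep, gauge, h]
      push_cast
      ring
    rw [smul_eq_mul, ← mul_assoc (qpow (gauge m i - gauge m j)), ← h1]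
    ring
  · exact ⟨0, Zq.zero_mem, by simp⟩

theorem gaugeIntegral_rep (m : ℕ) {u : Uh} (hu : u ∈ UZqEv) :
    GaugeIntegral (gauge m) ((irrep m).rep u) := by
  induction hu using Algebra.adjoin_induction with
  | mem x hx =>
    rcases hx with (hx | ⟨n, -, rfl⟩) | ⟨n, -, rfl⟩
    · rcases hx with rfl | rfl
      -- `K` acts by `q^(w/2)`, so evenness of the exponent is what keeps the entries in `ℤ[q,
      -- q⁻¹]`.
      · rw [map_pow, rep_K, qdiag_pow]
        refine GaugeIntegral.diagonal _ fun i => ?_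
        convert qpow_mem_Zq ((irrep m).w i) using 2
        push_cast; ring
      · rw [map_pow, rep_Kinv, qdiag_pow]
        refine GaugeIntegral.diagonal _ fun i => ?_
        convert qpow_mem_Zq (-(irrep m).w i) using 2
        push_cast; ring
    · exact gaugeIntegral_rep_Etil m n
    · exact gaugeIntegral_rep_Ftil m n
  | algebraMap r =>
    have h : (irrep m).rep (algebraMap Zq Uh r) = algebraMap ℚ⟦X⟧ _ (r : ℚ⟦X⟧) :=
      (irrep m).rep.commutes r
    rw [h, Matrix.algebraMap_eq_diagonal]
    exact GaugeIntegral.diagonal _ fun _ => r.2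
  | add x y _ _ hx hy => rw [map_add]; exact hx.add hy
  | mul x y _ _ hx hy => rw [map_mul]; exact hx.mul hy

end WeightRep

/-! ## Half-integral powers of `q` -/

/-- `q ^ (k/2) ℤ[q, q⁻¹]`, as a subgroup of `ℚ((h))`. -/
def halfPow (k : ℤ) : AddSubgroup ℚ⸨X⸩ where
  carrier := {x | ∃ p ∈ Zq, x = ((qpow (k / 2) * p : ℚ⟦X⟧) : ℚ⸨X⸩)}
  zero_mem' := ⟨0, Zq.zero_mem, by simp⟩
  add_mem' := by
    rintro _ _ ⟨p, hp, rfl⟩ ⟨r, hr, rfl⟩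
    exact ⟨p + r, Zq.add_mem hp hr, by rw [mul_add, PowerSeries.coe_add]⟩
  neg_mem' := by
    rintro _ ⟨p, hp, rfl⟩
    exact ⟨-p, Zq.neg_mem hp, by rw [mul_neg, PowerSeries.coe_neg]⟩

theorem mul_mem_halfPow {j k : ℤ} {x y : ℚ⸨X⸩} (hx : x ∈ halfPow j) (hy : y ∈ halfPow k) :
    x * y ∈ halfPow (j + k) := by
  obtain ⟨p, hp, rfl⟩ := hx
  obtain ⟨r, hr, rfl⟩ := hy
  refine ⟨p * r, Zq.mul_mem hp hr, ?_⟩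
  rw [← PowerSeries.coe_mul]
  congr 1
  push_cast
  rw [add_div, qpow_add]
  ring

/-- Integral powers of `q` are units of `ℤ[q, q⁻¹]`, so only the parity of the index matters; all
later bookkeeping of exponents is modulo 2. -/
theorem mem_halfPow_of_even_sub {j k : ℤ} (h : Even (j - k)) {x : ℚ⸨X⸩} (hx : x ∈ halfPow j) :
    x ∈ halfPow k := by
  obtain ⟨p, hp, rfl⟩ := hx
  obtain ⟨n, hn⟩ := h
  refine ⟨qpow n * p, Zq.mul_mem (qpow_mem_Zq n) hp, ?_⟩
  rw [← mul_assoc, ← qpow_add, show j = k + (n + n) by omega]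
  congr 3
  push_cast
  ring

theorem qpow_mem_halfPow (k : ℤ) : ((qpow (k / 2) : ℚ⟦X⟧) : ℚ⸨X⸩) ∈ halfPow k :=
  ⟨1, Zq.one_mem, by rw [mul_one]⟩

theorem one_mem_halfPow : (1 : ℚ⸨X⸩) ∈ halfPow 0 := by
  simpa [qpow_zero] using qpow_mem_halfPow 0

theorem coe_v_pow (n : ℕ) : ((v ^ n : Qv) : ℚ⸨X⸩) = ((qpow (n / 2) : ℚ⟦X⟧) : ℚ⸨X⸩) := by
  induction n with
  | zero => simp [qpow_zero]
  | succ n ih =>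
    have h : ((v : Qv) : ℚ⸨X⸩) = ((qpow (1 / 2) : ℚ⟦X⟧) : ℚ⸨X⸩) :=
      IntermediateField.AdjoinSimple.coe_gen _ _
    rw [pow_succ, MulMemClass.coe_mul, ih, h, ← PowerSeries.coe_mul, ← qpow_add]
    congr 2
    push_cast
    ring

theorem coe_v_pow_mem_halfPow (n : ℕ) : ((v ^ n : Qv) : ℚ⸨X⸩) ∈ halfPow n := by
  rw [coe_v_pow]
  simpa only [Int.cast_natCast] using qpow_mem_halfPow n

theorem coe_v_pow_inv (n : ℕ) :
    (((v ^ n)⁻¹ : Qv) : ℚ⸨X⸩) = ((qpow (-n / 2) : ℚ⟦X⟧) : ℚ⸨X⸩) := by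
  rw [IntermediateField.coe_inv]
  refine inv_eq_of_mul_eq_one_right ?_
  rw [coe_v_pow, ← PowerSeries.coe_mul, ← qpow_add, ← add_div, add_neg_cancel, zero_div, qpow_zero,
    PowerSeries.coe_one]

theorem coe_v_pow_inv_mem_halfPow (n : ℕ) : (((v ^ n)⁻¹ : Qv) : ℚ⸨X⸩) ∈ halfPow (-n) := by
  rw [coe_v_pow_inv]
  simpa only [Int.cast_neg, Int.cast_natCast] using qpow_mem_halfPow (-n)

/-! ## Parity in the representation ring -/

namespace RepRing

/-- Weights in `V_c` and in `V_a ⊗ V_b` have different parities unless `a + b + c` is odd. -/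
theorem mult_eq_zero {a b c : ℕ+} (h : Even ((a : ℕ) + b + c)) : mult a b c = 0 := by
  have h0 : WeightRep.intertwiners (WeightRep.irrep c)
      ((WeightRep.irrep a).tensor (WeightRep.irrep b)) = ⊥ := by
    rw [Submodule.eq_bot_iff]
    intro φ hφ
    ext p k : 1
    -- Commuting with `H` alone suffices: an entry of `φ` can be nonzero only between equal weights.
    have h1 := congrFun (congrFun (hφ (toUh (gen .H))) p) k
    rw [WeightRep.rep_toUh, WeightRep.rep_toUh, WeightRep.topAct_gen, WeightRep.topAct_gen,
      WeightRep.genAct, WeightRep.genAct, diagonal_mul, mul_diagonal, mul_comm, ← sub_eq_zero,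
      ← mul_sub, mul_eq_zero] at h1
    refine h1.resolve_right fun h2 => ?_
    have h3 : ((WeightRep.irrep a).tensor (WeightRep.irrep b)).w p = (WeightRep.irrep c).w k := by
      have h4 := congrArg PowerSeries.constantCoeff (sub_eq_zero.mp h2)
      rw [map_intCast, map_intCast] at h4
      exact_mod_cast h4
    -- Weights of `V_a ⊗ V_b` are congruent to `a + b` modulo 2, those of `V_c` to `c - 1`.
    simp only [WeightRep.tensor, WeightRep.irrep] at h3
    obtain ⟨n, hn⟩ := h
    omega
  rw [mult, h0, finrank_bot]

/-- The coefficient of `V_m` in `Y` lies in `q ^ ((k + m - 1)/2) ℤ[q, q⁻¹]`, for all `m`. -/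
def HasParity (k : ℤ) (Y : RepRing) : Prop :=
  ∀ m : ℕ+, ((show ℕ+ →₀ Qv from Y) m : ℚ⸨X⸩) ∈ halfPow (k + m - 1)

theorem HasParity.of_even_sub {j k : ℤ} (h : Even (j - k)) {Y : RepRing} (hY : HasParity j Y) :
    HasParity k Y := fun m => mem_halfPow_of_even_sub (by convert h using 1; ring) (hY m)

theorem HasParity.zero (k : ℤ) : HasParity k 0 := fun _ => (halfPow _).zero_mem

theorem HasParity.add {k : ℤ} {Y Z : RepRing} (hY : HasParity k Y) (hZ : HasParity k Z) :
    HasParity k (Y + Z) := fun m => (halfPow _).add_mem (hY m) (hZ m)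

theorem HasParity.sub {k : ℤ} {Y Z : RepRing} (hY : HasParity k Y) (hZ : HasParity k Z) :
    HasParity k (Y - Z) := fun m => (halfPow _).sub_mem (hY m) (hZ m)

theorem HasParity.sum {α : Type*} {k : ℤ} {s : Finset α} {Y : α → RepRing}
    (h : ∀ a ∈ s, HasParity k (Y a)) : HasParity k (∑ a ∈ s, Y a) :=
  Finset.sum_induction _ _ (fun _ _ => HasParity.add) (HasParity.zero k) h

theorem HasParity.smul {j k : ℤ} {y : Qv} {Y : RepRing} (hy : (y : ℚ⸨X⸩) ∈ halfPow j)
    (hY : HasParity k Y) : HasParity (j + k) (y • Y) := fun m => by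
  have h := mul_mem_halfPow hy (hY m)
  rw [← add_sub_assoc, ← add_assoc] at h
  exact h

theorem HasParity.V (m : ℕ+) : HasParity (1 - m) (V m) := fun n => by
  change ((Finsupp.single m (1 : Qv) n : Qv) : ℚ⸨X⸩) ∈ _
  rw [Finsupp.single_apply]
  split_ifs with h
  · subst h
    simpa using one_mem_halfPow
  · exact (halfPow _).zero_mem

theorem HasParity.one : HasParity 0 1 :=
  (HasParity.V 1).of_even_sub (k := 0) ⟨0, by simp⟩

theorem HasParity.tensorClass (a b : ℕ+) : HasParity (a + b) (tensorClass a b) := by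
  refine HasParity.sum fun c _ => ?_
  by_cases h : Even ((a : ℕ) + b + c)
  · rw [mult_eq_zero h, Nat.cast_zero, zero_smul]
    exact HasParity.zero _
  · have h1 : (((mult a b c : ℕ) : Qv) : ℚ⸨X⸩) ∈ halfPow 0 := by
      have := (halfPow 0).nsmul_mem one_mem_halfPow (mult a b c)
      simpa using this
    refine ((HasParity.V c).smul h1).of_even_sub ?_
    obtain ⟨n, hn⟩ := Nat.not_even_iff_odd.mp h
    exact ⟨n + 1 - c - a - b, by omega⟩

/-- The coefficients of `V_a` and `V_b` contribute `j + a - 1` and `k + b - 1`, and `V_a ⊗ V_b`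
contributes `a + b`; modulo 2 the dimensions cancel. -/
theorem HasParity.mul {j k : ℤ} {Y Z : RepRing} (hY : HasParity j Y) (hZ : HasParity k Z) :
    HasParity (j + k) (Y * Z) := by
  refine HasParity.sum fun a _ => HasParity.sum fun b _ => ?_
  refine ((HasParity.tensorClass a b).smul (mul_mem_halfPow (hY a) (hZ b))).of_even_sub ?_
  exact ⟨a + b - 1, by ring⟩

theorem HasParity.P (l : ℕ) : HasParity l (P l) := by
  induction l with
  | zero => exact HasParity.one
  | succ l ih =>
    push_cast
    -- All three terms of the new factor are odd: `V_2` has parity `1 - 2`, and its scalars are odd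
    -- powers of `q^(1/2)`.
    refine ih.mul (((HasParity.V 2).of_even_sub ⟨-1, by norm_num⟩).sub
      ((HasParity.one.smul (coe_v_pow_mem_halfPow _)).of_even_sub ⟨l, ?_⟩) |>.sub
      ((HasParity.one.smul (coe_v_pow_inv_mem_halfPow _)).of_even_sub ⟨-l - 1, ?_⟩))
    · push_cast; ring
    · push_cast; ring

end RepRing

/-! ## Quantum traces -/

theorem trace_rep_Kinv_mul_mem_halfPow (m : ℕ) {u : Uh} (hu : u ∈ UZqEv) :
    ((((WeightRep.irrep m).rep (Kinv * u)).trace : ℚ⟦X⟧) : ℚ⸨X⸩) ∈ halfPow (1 - m) := by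
  choose p hp h using WeightRep.gaugeIntegral_rep m hu
  -- `K⁻¹` acts on `v_i` by `q^(-(m-1-2i)/2) = q^((1-m)/2) q^i`, and the gauge factor is trivial on
  -- the diagonal.
  refine ⟨∑ i : Fin m, qpow ((i : ℕ) : ℤ) * p i i,
    Zq.sum_mem fun i _ => Zq.mul_mem (qpow_mem_Zq _) (hp i i), ?_⟩
  congr 1
  rw [map_mul, WeightRep.rep_Kinv, Matrix.trace, Finset.mul_sum]
  refine Finset.sum_congr rfl fun i _ => ?_
  rw [diag_apply, qdiag, diagonal_mul, h, sub_self, qpow_zero, one_mul, ← mul_assoc, ← qpow_add]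
  congr 2
  simp only [WeightRep.irrep]
  push_cast
  ring

theorem trq_smul (y : Qv) (Y : RepRing) (u : Uh) : trq (y • Y) u = y * trq Y u := by
  refine (Finsupp.sum_smul_index (g := (show ℕ+ →₀ Qv from Y)) fun _ => by simp).trans ?_
  refine Eq.trans ?_ (Finsupp.mul_sum (y : ℚ⸨X⸩) (show ℕ+ →₀ Qv from Y)).symm
  simp only [MulMemClass.coe_mul, mul_assoc]

theorem trq_mem_halfPow {k : ℤ} {Y : RepRing} (hY : RepRing.HasParity k Y) {u : Uh}
    (hu : u ∈ UZqEv) : trq Y u ∈ halfPow k := by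
  refine (halfPow k).sum_mem fun m _ => ?_
  have h := mul_mem_halfPow (hY m) (trace_rep_Kinv_mul_mem_halfPow m hu)
  rwa [show k + (m : ℕ) - 1 + (1 - (m : ℕ)) = k by ring] at h

theorem braceFact_qpow_ne_zero (l : ℕ) : braceFact (qpow 1) l ≠ 0 := by
  refine Finset.prod_ne_zero_iff.mpr fun i _ h => ?_
  -- The coefficient of `h` in `q^(i+1) - 1` is `i + 1`.
  have h1 := congrArg (PowerSeries.coeff 1) h
  rw [qpow_one_pow, map_sub, coeff_qpow, PowerSeries.coeff_one] at h1
  norm_num at h1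
  norm_cast at h1

theorem coe_braceFact (l : ℕ) : ((braceFact (v ^ 2) l : Qv) : ℚ⸨X⸩) =
    ((braceFact (qpow 1) l : ℚ⟦X⟧) : ℚ⸨X⸩) := by
  have h : ((v ^ 2 : Qv) : ℚ⸨X⸩) = HahnSeries.ofPowerSeries ℤ ℚ (qpow 1) := by
    rw [coe_v_pow]; norm_num
  have h2 : (Qv.val) (v ^ 2) = HahnSeries.ofPowerSeries ℤ ℚ (qpow 1) := h
  change Qv.val _ = HahnSeries.ofPowerSeries ℤ ℚ _
  simp only [braceFact, map_prod, map_sub, map_pow, map_one] at h2 ⊢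
  simp only [h2]

end QSl2

/-! ### Conclusion -/

theorem mainTheorem7 (l : ℕ) (u : QSl2.Uh) (hu : u ∈ QSl2.UZqEv) :
    ∃ p ∈ QSl2.Zq,
      ((QSl2.braceFact (QSl2.qpow 1) l : PowerSeries ℚ) : LaurentSeries ℚ) *
          QSl2.trq (QSl2.RepRing.Ptilde l) u =
        ((p : PowerSeries ℚ) : LaurentSeries ℚ) := by
  have hne : ((QSl2.braceFact (QSl2.qpow 1) l : PowerSeries ℚ) : LaurentSeries ℚ) ≠ 0 := by
    intro h
    exact QSl2.braceFact_qpow_ne_zero l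
      (HahnSeries.ofPowerSeries_injective (h.trans (map_zero _).symm))
  -- The normalising `q^(l/2)` and the trace against `P_l` each have index `l`, and `l + l` is even.
  obtain ⟨p, hp, h⟩ := QSl2.mem_halfPow_of_even_sub (k := 0) ⟨(l : ℤ), by ring⟩
    (QSl2.mul_mem_halfPow (QSl2.coe_v_pow_mem_halfPow l)
      (QSl2.trq_mem_halfPow (QSl2.RepRing.HasParity.P l) hu))
  refine ⟨p, hp, ?_⟩
  rw [Int.cast_zero, zero_div, QSl2.qpow_zero, one_mul] at h
  rw [QSl2.RepRing.Ptilde, QSl2.trq_smul, ← h, div_eq_mul_inv, MulMemClass.coe_mul,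
    IntermediateField.coe_inv, QSl2.coe_braceFact]
  field_simp
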